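/- Let $K\subset[0,1]$ be the middle-thirds Cantor set and, for $a\in[0,1]$, let $K+a=\{x: x-a\in K\}$ and $E_a=K\cap(K+a)$. A set $E\subset\mathbb R^n$ is called statistically self-similar, generated by $\psi_1,\dots,\psi_m$ and $(\mathcal N_k)_{k\ge1}$, if: each $\psi_j:\mathbb R^n\to\mathbb R^n$ is a similitude, $|\psi_j(x)-\psi_j(y)|=r_j|x-y|$ for all $x,y$, with $0<r_j<1$; each $\mathcal N_k$ is a non-empty subset of $\{1,\dots,m\}$; the open set condition holds, i.e. there is a non-empty bounded open set $V$ such that $\psi_j(V)\subset V$ for all $j$ and $\psi_i(V)\cap\psi_j(V)=\emptyset$ for $i\ne j$; and $E$ is the non-empty compact set such that, for every non-empty compact $F$, the sets $\bigcup_{(j_1,\dots,j_k)\in\mathcal N_1\times\dots\times\mathcal N_k}(\psi_{j_1}\circ\dots\circ\psi_{j_k})(F)$ converge to $E$ in the Hausdorff metric as $k\to\infty$. Theorem. For Lebesgue-almost every $a\in[0,1]$, with triadic expansion $a=\sum_{k\ge1}a_k3^{-k}$, $a_k\in\{0,1,2\}$, the set $E_a$ is statistically self-similar; more precisely, it is the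 statistically self-similar set generated by $\psi_1(x)=\frac x3$, $\psi_2(x)=\frac x3+\frac23$ and the sets $\mathcal N_{a,k}$, $k\ge1$, where $$\mathcal N_{a,k}=\begin{cases}\{1,2\},& a_1+\dots+a_{k-1}\text{ even and }a_k=0,\\ \{2\},& a_1+\dots+a_{k-1}\text{ even and }a_k\ne0,\\ \{1,2\},& a_1+\dots+a_{k-1}\text{ odd and }a_k=2,\\ \{1\},& a_1+\dots+a_{k-1}\text{ odd and }a_k\neq2.\end{cases}$$ Moreover, the Hausdorff dimension of $E_a$ is equal to $\dfrac{\ln2}{3\ln3}$. -/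

import Mathlib

open MeasureTheory Filter Topology

section General

variable {X : Type*} [MetricSpace X]

/-- A similitude of ratio `r`, `0 < r < 1`. -/
structure IsSimilitude (ψ : X → X) (r : ℝ) : Prop where
  ratio_pos : 0 < r
  ratio_lt_one : r < 1
  dist_eq : ∀ x y, dist (ψ x) (ψ y) = r * dist x y

/-- The composition `ψ_{w 0} ∘ ⋯ ∘ ψ_{w (k-1)}` along a word `w` of length `k`
(the last letter is applied first). -/
def wordMap {m : ℕ} (ψ : Fin m → X → X) : {k : ℕ} → (Fin k → Fin m) → X → X
  | 0, _ => id
  | k + 1, w => wordMap ψ (Fin.init w) ∘ ψ (w (Fin.last k))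

/-- The words of length `k` whose `i`-th letter lies in `N i`. Positions are counted from `0`, so
`N i` is the set of letters allowed at the `(i+1)`-st place. -/
def admissibleWords {m : ℕ} (N : ℕ → Set (Fin m)) (k : ℕ) : Set (Fin k → Fin m) :=
  {w | ∀ i : Fin k, w i ∈ N i}

/-- The union of the images of `F` under `ψ_{j_1} ∘ ⋯ ∘ ψ_{j_k}` over all admissible words
`(j_1, …, j_k)` of length `k`. -/
def levelImage {m : ℕ} (ψ : Fin m → X → X) (N : ℕ → Set (Fin m)) (k : ℕ) (F : Set X) : Set X :=
  ⋃ w ∈ admissibleWords N k, wordMap ψ w '' F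

/-- The open set condition. -/
def OpenSetCondition {m : ℕ} (ψ : Fin m → X → X) : Prop :=
  ∃ V : Set X, IsOpen V ∧ V.Nonempty ∧ Bornology.IsBounded V ∧
    (∀ j, ψ j '' V ⊆ V) ∧ ∀ i j, i ≠ j → Disjoint (ψ i '' V) (ψ j '' V)

/-- `E` is the statistically self-similar set generated by the maps `ψ_j` and the digit sets `N`:
the `ψ_j` are contracting similitudes that satisfy the open set condition, the digit sets are
non-empty, and `E` is the non-empty compact set which is the limit, in the Hausdorff metric, of the
sets `levelImage ψ N k F` for every non-empty compact set `F`. -/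
structure IsStatSelfSimilarWith {m : ℕ} (ψ : Fin m → X → X) (N : ℕ → Set (Fin m))
    (E : Set X) : Prop where
  similitude : ∀ j, ∃ r, IsSimilitude (ψ j) r
  digits_nonempty : ∀ k, (N k).Nonempty
  openSetCondition : OpenSetCondition ψ
  isCompact : IsCompact E
  nonempty : E.Nonempty
  tendsto : ∀ F : Set X, IsCompact F → F.Nonempty →
    Tendsto (fun k => Metric.hausdorffEDist (levelImage ψ N k F) E) atTop (𝓝 0)

/-- `E` is statistically self-similar. -/
def IsStatSelfSimilar (E : Set X) : Prop :=
  ∃ (m : ℕ) (ψ : Fin m → X → X) (N : ℕ → Set (Fin m)), IsStatSelfSimilarWith ψ N E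

end General

/-- The two similitudes `x ↦ x / 3` and `x ↦ x / 3 + 2 / 3` that generate the Cantor set. -/
noncomputable def cantorMap : Fin 2 → ℝ → ℝ :=
  ![fun x => x / 3, fun x => x / 3 + 2 / 3]

/-- The intersection `K ∩ (K + a)` of the middle-thirds Cantor set with its translate by `a`. -/
def cantorInter (a : ℝ) : Set ℝ :=
  cantorSet ∩ {x | x - a ∈ cantorSet}

/-- The `k`-th triadic digit of `a`, counted from `k = 0` (the digit of weight `3 ^ (-(k+1))`). -/
noncomputable def triadicDigit (a : ℝ) (k : ℕ) : ℕ :=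
  (Real.digits a 3 k : Fin 3).val

open Classical in
/-- The set of letters allowed at position `k`, read off from the triadic digit `a_k` of `a` and
the parity of the sum of the preceding digits. The letter `0` stands for the map `x / 3` and the
letter `1` for the map `x / 3 + 2 / 3`. -/
noncomputable def cantorDigitSet (a : ℝ) (k : ℕ) : Set (Fin 2) :=
  if Even (∑ i ∈ Finset.range k, triadicDigit a i) then
    if triadicDigit a k = 0 then {0, 1} else {1}
  else
    if triadicDigit a k = 2 then {0, 1} else {0}

/-! Let `E_r = K ∩ (K + r)` with `|r| ≤ 1`. Since `K` consists of two copies of itself scaled by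
`1/3`, in `[0,1/3]` and `[2/3,1]`, the set `E_r` is two scaled copies of `E_{3r}` if `|r| < 1/3`,
one right copy of `E_{3r-2}` if `r > 1/3`, and one left copy of `E_{3r+2}` if `r < -1/3`. Iterating
from `r = a` yields residuals `r_k ∈ (-1,1)` with `r_k ≡ 3^k a` mod 2. The parity of the digit sum
tells which representative of the fractional part of `3^k a` occurs, which gives the digit sets
(`cantorInter_cantorResidual`). Triadic rationals, a null set, are excluded so that no boundary case
occurs.

If the places with two choices have frequency `θ > 0`, the dimension is `θ log 2 / log 3`. Covering
by cylinders gives the upper bound (`dimH_le_of_eq_levelImage`); for the lower bound, reading binary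
digits at the free places is a Hölder map onto a set containing `[0,1)`
(`le_dimH_of_eq_levelImage`).

Place `k` is free iff `3^k a` is within `1/3` of an even integer, that is, iff `3^k (a/2)` is within
`1/6` of an integer. Under tripling on the circle these events are pairwise independent of measure
`1/3`, so the strong law gives `θ = 1/3` almost surely. -/

/-! ### Level images and their convergence -/

section Words

variable {X : Type*} {m : ℕ} {ψ : Fin m → X → X} {N : ℕ → Set (Fin m)}

lemma levelImage_zero (F : Set X) : levelImage ψ N 0 F = F := by
  ext x
  simp [levelImage, admissibleWords, wordMap]

lemma levelImage_succ (k : ℕ) (F : Set X) :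
    levelImage ψ N (k + 1) F = levelImage ψ N k (⋃ j ∈ N k, ψ j '' F) := by
  ext x
  simp only [levelImage, admissibleWords, Set.mem_iUnion, Set.mem_image, Set.mem_ofPred_eq,
    exists_prop]
  constructor
  · rintro ⟨w, hw, y, hy, rfl⟩
    exact ⟨Fin.init w, fun i => hw i.castSucc, ψ (w (Fin.last k)) y,
      ⟨w (Fin.last k), by simpa using hw (Fin.last k), y, hy, rfl⟩, rfl⟩
  · rintro ⟨w, hw, z, ⟨j, hj, y, hy, rfl⟩, rfl⟩
    refine ⟨Fin.snoc w j, fun i => ?_, y, hy, by simp [wordMap]⟩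
    refine Fin.lastCases ?_ (fun i => ?_) i
    · simpa using hj
    · simpa using hw i

/-- Unrolls a recursion whose rule changes with the level; `S k` will be the residual intersection
`K ∩ (K + r_k)`. -/
lemma eq_levelImage_of_step {S : ℕ → Set X} (hS : ∀ k, S k = ⋃ j ∈ N k, ψ j '' S (k + 1)) (k : ℕ) :
    S 0 = levelImage ψ N k (S k) := by
  induction k with
  | zero => rw [levelImage_zero]
  | succ k ih => rw [levelImage_succ, ← hS k, ← ih]

lemma wordMap_mem_levelImage {k : ℕ} {w : Fin k → Fin m} (hw : w ∈ admissibleWords N k)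
    {F : Set X} {x : X} (hx : x ∈ F) : wordMap ψ w x ∈ levelImage ψ N k F :=
  Set.mem_biUnion hw (Set.mem_image_of_mem _ hx)

variable [MetricSpace X]

lemma dist_wordMap {r : ℝ} (hψ : ∀ j x y, dist (ψ j x) (ψ j y) = r * dist x y) {k : ℕ}
    (w : Fin k → Fin m) (x y : X) :
    dist (wordMap ψ w x) (wordMap ψ w y) = r ^ k * dist x y := by
  induction k generalizing x y with
  | zero => simp [wordMap]
  | succ k ih =>
    simp only [wordMap, Function.comp_apply, ih, hψ]
    ring

/-- If `E` is, for every `k`, the level-`k` image of a non-empty subset of a fixed bounded set,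
then the level-`k` images of any compact set converge to `E`. -/
lemma tendsto_hausdorffEDist_levelImage {r : ℝ} (hr₀ : 0 ≤ r) (hr₁ : r < 1)
    (hψ : ∀ j x y, dist (ψ j x) (ψ j y) = r * dist x y) {S : ℕ → Set X} {E B : Set X}
    (hE : ∀ k, E = levelImage ψ N k (S k)) (hne : ∀ k, (S k).Nonempty) (hSB : ∀ k, S k ⊆ B)
    (hB : Bornology.IsBounded B) {F : Set X} (hF : IsCompact F) (hFne : F.Nonempty) :
    Tendsto (fun k => Metric.hausdorffEDist (levelImage ψ N k F) E) atTop (𝓝 0) := by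
  -- Bounds all distances between `F` and `S k` uniformly in `k`; words of length `k` shrink them to
  -- at most `r ^ k * C`.
  set C := Metric.diam (F ∪ B)
  have hC : ∀ x ∈ F, ∀ y ∈ B, dist x y ≤ C := fun x hx y hy =>
    Metric.dist_le_diam_of_mem (hF.isBounded.union hB) (Or.inl hx) (Or.inr hy)
  have hlim : Tendsto (fun k => ENNReal.ofReal (r ^ k * C)) atTop (𝓝 0) := by
    have := (tendsto_pow_atTop_nhds_zero_of_lt_one hr₀ hr₁).mul_const C
    simpa using ENNReal.tendsto_ofReal this
  refine tendsto_of_tendsto_of_tendsto_of_le_of_le tendsto_const_nhds hlim (fun _ => zero_le)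
    fun k => ?_
  have key : ∀ (w : Fin k → Fin m), ∀ x ∈ F, ∀ y ∈ S k,
      edist (wordMap ψ w x) (wordMap ψ w y) ≤ ENNReal.ofReal (r ^ k * C) := by
    intro w x hx y hy
    rw [edist_dist, dist_wordMap hψ]
    gcongr
    exact hC x hx y (hSB k hy)
  refine Metric.hausdorffEDist_le_of_mem_edist ?_ ?_
  · intro x hx
    simp only [levelImage, Set.mem_iUnion, exists_prop] at hx
    obtain ⟨w, hw, f, hf, rfl⟩ := hx
    obtain ⟨e, he⟩ := hne k
    refine ⟨wordMap ψ w e, ?_, key w f hf e he⟩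
    rw [hE k]
    exact wordMap_mem_levelImage hw he
  · intro x hx
    rw [hE k] at hx
    simp only [levelImage, Set.mem_iUnion, exists_prop] at hx
    obtain ⟨w, hw, e, he, rfl⟩ := hx
    obtain ⟨f, hf⟩ := hFne
    refine ⟨wordMap ψ w f, wordMap_mem_levelImage hw hf, ?_⟩
    rw [edist_comm]
    exact key w f hf e he

end Words

/-! ### The two Cantor similitudes -/

section CantorMap

lemma cantorMap_zero (x : ℝ) : cantorMap 0 x = x / 3 := rfl

lemma cantorMap_one (x : ℝ) : cantorMap 1 x = x / 3 + 2 / 3 := rfl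

lemma dist_cantorMap (j : Fin 2) (x y : ℝ) :
    dist (cantorMap j x) (cantorMap j y) = 1 / 3 * dist x y := by
  have h : cantorMap j x - cantorMap j y = 1 / 3 * (x - y) := by
    fin_cases j
    · simp only [Fin.zero_eta, cantorMap_zero]; ring
    · simp only [Fin.mk_one, cantorMap_one]; ring
  rw [Real.dist_eq, Real.dist_eq, h, abs_mul, abs_of_pos (by norm_num : (0 : ℝ) < 1 / 3)]

lemma isSimilitude_cantorMap (j : Fin 2) : IsSimilitude (cantorMap j) (1 / 3) :=
  ⟨by norm_num, by norm_num, dist_cantorMap j⟩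

lemma openSetCondition_cantorMap : OpenSetCondition cantorMap := by
  have h0 : ∀ x ∈ Set.Ioo (0 : ℝ) 1, cantorMap 0 x ∈ Set.Ioo (0 : ℝ) (1 / 3) := by
    intro x hx; rw [cantorMap_zero]; constructor <;> linarith [hx.1, hx.2]
  have h1 : ∀ x ∈ Set.Ioo (0 : ℝ) 1, cantorMap 1 x ∈ Set.Ioo (2 / 3 : ℝ) 1 := by
    intro x hx; rw [cantorMap_one]; constructor <;> linarith [hx.1, hx.2]
  have hd : Disjoint (cantorMap 0 '' Set.Ioo 0 1) (cantorMap 1 '' Set.Ioo 0 1) := by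
    rw [Set.disjoint_left]
    rintro _ ⟨x, hx, rfl⟩ ⟨y, hy, hxy⟩
    have hx' := (h0 x hx).2
    have hy' := (h1 y hy).1
    linarith
  refine ⟨Set.Ioo 0 1, isOpen_Ioo, ⟨1 / 2, by norm_num, by norm_num⟩, Metric.isBounded_Ioo 0 1,
    ?_, ?_⟩
  · intro j
    rw [Set.image_subset_iff]
    intro x hx
    fin_cases j
    · exact ⟨(h0 x hx).1, (h0 x hx).2.trans (by norm_num)⟩
    · exact ⟨lt_trans (by norm_num) (h1 x hx).1, (h1 x hx).2⟩
  · intro i j hij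
    fin_cases i <;> fin_cases j
    · exact absurd rfl hij
    · exact hd
    · exact hd.symm
    · exact absurd rfl hij

end CantorMap

/-! ### Self-similar decomposition of `K ∩ (K + r)` -/

section CantorInter

lemma mem_cantorSet_iff (x : ℝ) :
    x ∈ cantorSet ↔ 3 * x ∈ cantorSet ∨ 3 * x - 2 ∈ cantorSet := by
  conv_lhs => rw [cantorSet_eq_union_halves]
  constructor
  · rintro (⟨y, hy, rfl⟩ | ⟨y, hy, rfl⟩)
    · left; convert hy using 1; ring
    · right; convert hy using 1; ring
  · rintro (h | h)
    · exact Or.inl ⟨_, h, by ring⟩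
    · exact Or.inr ⟨_, h, by ring⟩

lemma cantorInter_subset (r : ℝ) : cantorInter r ⊆ Set.Icc 0 1 :=
  Set.inter_subset_left.trans cantorSet_subset_unitInterval

lemma isCompact_cantorInter (r : ℝ) : IsCompact (cantorInter r) :=
  isCompact_cantorSet.inter_right (isClosed_cantorSet.preimage (by fun_prop))

lemma mem_cantorMap_image (j : Fin 2) (x : ℝ) (S : Set ℝ) :
    x ∈ cantorMap j '' S ↔ 3 * x - 2 * (j : ℕ) ∈ S := by
  constructor
  · rintro ⟨y, hy, rfl⟩
    convert hy using 1
    fin_cases j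
    · simp only [Fin.zero_eta, cantorMap_zero]; norm_num; ring
    · simp only [Fin.mk_one, cantorMap_one]; norm_num; ring
  · intro h
    refine ⟨_, h, ?_⟩
    fin_cases j
    · simp only [Fin.zero_eta, cantorMap_zero]; norm_num
    · simp only [Fin.mk_one, cantorMap_one]; norm_num; ring

/-- The two thirds of `K` are `1/3` apart, so a shift smaller than `1/3` cannot make a third of `K`
meet the opposite third of `K + r`; only matching thirds contribute. -/
lemma cantorInter_of_abs_lt {r : ℝ} (h : |r| < 1 / 3) :
    cantorInter r = ⋃ j ∈ ({0, 1} : Set (Fin 2)), cantorMap j '' cantorInter (3 * r) := by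
  obtain ⟨h1, h2⟩ := abs_lt.1 h
  ext x
  simp only [Set.mem_iUnion, mem_cantorMap_image, cantorInter, Set.mem_inter_iff,
    Set.mem_ofPred_eq, exists_prop, Set.mem_insert_iff, Set.mem_singleton_iff, exists_eq_or_imp,
    exists_eq_left]
  rw [mem_cantorSet_iff x, mem_cantorSet_iff (x - r)]
  have e1 : 3 * (x - r) = 3 * x - 3 * r := by ring
  have e2 : 3 * x - 3 * r - 2 = 3 * x - 2 - 3 * r := by ring
  have hK := @cantorSet_subset_unitInterval
  simp only [e1, e2, Fin.val_zero, Fin.val_one, Nat.cast_zero, Nat.cast_one, mul_zero, mul_one,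
    sub_zero]
  constructor
  · rintro ⟨ha | ha, hb | hb⟩
    · exact Or.inl ⟨ha, hb⟩
    · linarith [(hK ha).2, (hK hb).1]
    · linarith [(hK ha).1, (hK hb).2]
    · exact Or.inr ⟨ha, hb⟩
  · rintro (⟨ha, hb⟩ | ⟨ha, hb⟩)
    · exact ⟨Or.inl ha, Or.inl hb⟩
    · exact ⟨Or.inr ha, Or.inr hb⟩

lemma cantorInter_of_gt {r : ℝ} (h : 1 / 3 < r) :
    cantorInter r = ⋃ j ∈ ({1} : Set (Fin 2)), cantorMap j '' cantorInter (3 * r - 2) := by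
  ext x
  simp only [Set.mem_iUnion, mem_cantorMap_image, cantorInter, Set.mem_inter_iff,
    Set.mem_ofPred_eq, exists_prop, Set.mem_singleton_iff, exists_eq_left]
  rw [mem_cantorSet_iff x, mem_cantorSet_iff (x - r)]
  have e2 : 3 * x - 2 - (3 * r - 2) = 3 * (x - r) := by ring
  have hK := @cantorSet_subset_unitInterval
  simp only [e2, Fin.val_one, Nat.cast_one, mul_one]
  constructor
  · rintro ⟨ha | ha, hb | hb⟩
    · linarith [(hK ha).2, (hK hb).1]
    · linarith [(hK ha).2, (hK hb).1]
    · exact ⟨ha, hb⟩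
    · linarith [(hK ha).2, (hK hb).1]
  · rintro ⟨ha, hb⟩
    exact ⟨Or.inr ha, Or.inl hb⟩

lemma cantorInter_of_lt {r : ℝ} (h : r < -1 / 3) :
    cantorInter r = ⋃ j ∈ ({0} : Set (Fin 2)), cantorMap j '' cantorInter (3 * r + 2) := by
  ext x
  simp only [Set.mem_iUnion, mem_cantorMap_image, cantorInter, Set.mem_inter_iff,
    Set.mem_ofPred_eq, exists_prop, Set.mem_singleton_iff, exists_eq_left]
  rw [mem_cantorSet_iff x, mem_cantorSet_iff (x - r)]
  have e2 : 3 * x - (3 * r + 2) = 3 * (x - r) - 2 := by ring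
  have hK := @cantorSet_subset_unitInterval
  simp only [e2, Fin.val_zero, Nat.cast_zero, mul_zero, sub_zero]
  constructor
  · rintro ⟨ha | ha, hb | hb⟩
    · linarith [(hK ha).1, (hK hb).2]
    · exact ⟨ha, hb⟩
    · linarith [(hK ha).1, (hK hb).2]
    · linarith [(hK ha).1, (hK hb).2]
  · rintro ⟨ha, hb⟩
    exact ⟨Or.inl ha, Or.inr hb⟩

/-- This is `K - K = [-1, 1]` at finite level: one of `3r + 2`, `3r`, `3r - 2` always lies in `[-1,
1]` again. The endpoints `±1/3` are harmless here, as only one common point is needed; compactness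
then passes to `K`. -/
lemma preCantorSet_inter_translate_nonempty (n : ℕ) {r : ℝ} (hr : |r| ≤ 1) :
    (preCantorSet n ∩ {x | x - r ∈ preCantorSet n}).Nonempty := by
  induction n generalizing r with
  | zero =>
    obtain ⟨h1, h2⟩ := abs_le.1 hr
    rcases le_total 0 r with h | h
    · exact ⟨r, ⟨h, h2⟩, by simp⟩
    · exact ⟨0, by simp, by simpa using ⟨h, by linarith⟩⟩
  | succ n ih =>
    obtain ⟨h1, h2⟩ := abs_le.1 hr
    rcases lt_or_ge r (-(1 / 3)) with h | h
    · obtain ⟨y, hy, hy'⟩ := ih (r := 3 * r + 2) (abs_le.2 ⟨by linarith, by linarith⟩)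
      exact ⟨y / 3, Or.inl ⟨y, hy, rfl⟩, Or.inr ⟨_, hy', by ring⟩⟩
    rcases le_or_gt r (1 / 3) with h' | h'
    · obtain ⟨y, hy, hy'⟩ := ih (r := 3 * r) (abs_le.2 ⟨by linarith, by linarith⟩)
      exact ⟨y / 3, Or.inl ⟨y, hy, rfl⟩, Or.inl ⟨_, hy', by ring⟩⟩
    · obtain ⟨y, hy, hy'⟩ := ih (r := 3 * r - 2) (abs_le.2 ⟨by linarith, by linarith⟩)
      exact ⟨(2 + y) / 3, Or.inr ⟨y, hy, rfl⟩, Or.inl ⟨_, hy', by ring⟩⟩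

lemma cantorInter_nonempty {r : ℝ} (hr : |r| ≤ 1) : (cantorInter r).Nonempty := by
  have hcl : ∀ n, IsClosed (preCantorSet n ∩ {x | x - r ∈ preCantorSet n}) := fun n =>
    (isClosed_preCantorSet n).inter ((isClosed_preCantorSet n).preimage (by fun_prop))
  obtain ⟨x, hx⟩ := IsCompact.nonempty_iInter_of_sequence_nonempty_isCompact_isClosed
    (fun n => preCantorSet n ∩ {x | x - r ∈ preCantorSet n})
    (fun n x hx => ⟨preCantorSet_antitone n.le_succ hx.1, preCantorSet_antitone n.le_succ hx.2⟩)
    (fun n => preCantorSet_inter_translate_nonempty n hr)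
    (isCompact_Icc.of_isClosed_subset (hcl 0) Set.inter_subset_left) hcl
  rw [Set.mem_iInter] at hx
  exact ⟨x, Set.mem_iInter.2 fun n => (hx n).1, Set.mem_iInter.2 fun n => (hx n).2⟩

end CantorInter

/-! ### Triadic digits and the residual translations -/

section Digits

lemma triadicDigit_eq (a : ℝ) (k : ℕ) : triadicDigit a k = ⌊3 ^ (k + 1) * a⌋₊ % 3 := by
  simp [triadicDigit, Real.digits, Fin.ofNat, mul_comm]

lemma natFloor_pow_succ (a : ℝ) (k : ℕ) :
    ⌊3 ^ (k + 1) * a⌋₊ = 3 * ⌊3 ^ k * a⌋₊ + triadicDigit a k := by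
  have h : ⌊3 ^ (k + 1) * a⌋₊ / 3 = ⌊3 ^ k * a⌋₊ := by
    rw [← Nat.floor_div_natCast]
    congr 1
    push_cast
    ring
  rw [triadicDigit_eq, ← h, Nat.div_add_mod]

/-- As 3 is odd, appending the digit `d` changes the parity of the floor exactly by that of `d`. -/
lemma even_sum_triadicDigit_iff {a : ℝ} (ha : a ∈ Set.Ico 0 1) (k : ℕ) :
    Even (∑ i ∈ Finset.range k, triadicDigit a i) ↔ Even ⌊3 ^ k * a⌋₊ := by
  induction k with
  | zero => simp [Nat.floor_eq_zero.2 ha.2]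
  | succ k ih =>
    rw [Finset.sum_range_succ, natFloor_pow_succ, Nat.even_add, Nat.even_add, ih, Nat.even_mul]
    simp [show ¬ Even 3 by decide]

/-- The fractional part of `3 ^ k * a`. -/
noncomputable def triadicShift (a : ℝ) (k : ℕ) : ℝ := Int.fract (3 ^ k * a)

lemma triadicShift_eq {a : ℝ} (ha : 0 ≤ a) (k : ℕ) :
    triadicShift a k = 3 ^ k * a - ⌊3 ^ k * a⌋₊ := by
  rw [triadicShift, Int.fract, ← natCast_floor_eq_intCast_floor (by positivity)]

lemma triadicShift_succ {a : ℝ} (ha : 0 ≤ a) (k : ℕ) :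
    triadicShift a (k + 1) = 3 * triadicShift a k - triadicDigit a k := by
  rw [triadicShift_eq ha, triadicShift_eq ha, natFloor_pow_succ]
  push_cast
  ring

lemma triadicDigit_lt (a : ℝ) (k : ℕ) : triadicDigit a k < 3 := by
  rw [triadicDigit_eq]; omega

lemma triadicShift_lt_one (a : ℝ) (k : ℕ) : triadicShift a k < 1 := Int.fract_lt_one _

lemma triadicShift_pos {a : ℝ} (h : ∀ (k : ℕ) (n : ℤ), 3 ^ k * a ≠ n) (k : ℕ) :
    0 < triadicShift a k :=
  Int.fract_pos.2 (h k _)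

open Classical in
/-- The translation parameter `r` for which the part of `K ∩ (K + a)` in a level-`k` cylinder is
a scaled copy of `K ∩ (K + r)`. -/
noncomputable def cantorResidual (a : ℝ) (k : ℕ) : ℝ :=
  if Even (∑ i ∈ Finset.range k, triadicDigit a i) then triadicShift a k else triadicShift a k - 1

lemma abs_cantorResidual_le (a : ℝ) (k : ℕ) : |cantorResidual a k| ≤ 1 := by
  have h0 : 0 ≤ triadicShift a k := Int.fract_nonneg _
  have h1 := triadicShift_lt_one a k
  rw [cantorResidual, abs_le]
  split_ifs <;> constructor <;> linarith

lemma cantorResidual_zero {a : ℝ} (ha : a ∈ Set.Ico 0 1) : cantorResidual a 0 = a := by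
  simp [cantorResidual, triadicShift, Int.fract_eq_self.2 ha]

/-- The next digit locates the residual relative to `±1/3`, strictly because `a` is not triadic. A
digit 1 flips the parity and hence the sign of the residual; digits 0 and 2 keep it. -/
lemma cantorInter_cantorResidual {a : ℝ} (ha : 0 ≤ a) (h : ∀ (k : ℕ) (n : ℤ), 3 ^ k * a ≠ n)
    (k : ℕ) : cantorInter (cantorResidual a k) =
      ⋃ j ∈ cantorDigitSet a k, cantorMap j '' cantorInter (cantorResidual a (k + 1)) := by
  have hs := triadicShift_succ ha k
  have h0 := triadicShift_pos h (k + 1)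
  have h1 := triadicShift_lt_one a (k + 1)
  have h0' := triadicShift_pos h k
  have h1' := triadicShift_lt_one a k
  have hlt := triadicDigit_lt a k
  unfold cantorResidual cantorDigitSet
  by_cases he : Even (∑ i ∈ Finset.range k, triadicDigit a i)
  · simp only [Finset.sum_range_succ, Nat.even_add, he, if_true, true_iff]
    generalize hd : triadicDigit a k = d at *
    interval_cases d
    · norm_num at hs
      rw [if_pos rfl, if_pos (by decide), cantorInter_of_abs_lt, hs]
      rw [abs_lt]; constructor <;> linarith
    · norm_num at hs
      rw [if_neg (by decide), if_neg (by decide), cantorInter_of_gt (by linarith), hs,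
        show ∀ x : ℝ, 3 * x - 1 - 1 = 3 * x - 2 from fun x => by ring]
    · norm_num at hs
      rw [if_neg (by decide), if_pos (by decide), cantorInter_of_gt (by linarith), hs]
  · simp only [Finset.sum_range_succ, Nat.even_add, he, if_false, false_iff]
    generalize hd : triadicDigit a k = d at *
    interval_cases d
    · norm_num at hs
      rw [if_neg (by decide), if_neg (by decide), cantorInter_of_lt (by linarith), hs,
        show ∀ x : ℝ, 3 * (x - 1) + 2 = 3 * x - 1 from fun x => by ring]
    · norm_num at hs
      rw [if_neg (by decide), if_pos (by decide), cantorInter_of_lt (by linarith), hs,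
        show ∀ x : ℝ, 3 * (x - 1) + 2 = 3 * x - 1 from fun x => by ring]
    · norm_num at hs
      rw [if_pos rfl, if_neg (by decide), cantorInter_of_abs_lt, hs,
        show ∀ x : ℝ, 3 * (x - 1) = 3 * x - 2 - 1 from fun x => by ring]
      rw [abs_lt]; constructor <;> linarith

lemma cantorDigitSet_nonempty (a : ℝ) (k : ℕ) : (cantorDigitSet a k).Nonempty := by
  unfold cantorDigitSet
  split_ifs <;> simp

lemma cantorInter_eq_levelImage {a : ℝ} (ha : a ∈ Set.Ico 0 1)
    (h : ∀ (k : ℕ) (n : ℤ), 3 ^ k * a ≠ n) (k : ℕ) :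
    cantorInter a =
      levelImage cantorMap (cantorDigitSet a) k (cantorInter (cantorResidual a k)) := by
  rw [← eq_levelImage_of_step (S := fun k => cantorInter (cantorResidual a k))
    (cantorInter_cantorResidual ha.1 h) k, cantorResidual_zero ha]

theorem isStatSelfSimilarWith_cantorInter {a : ℝ} (ha : a ∈ Set.Ico 0 1)
    (h : ∀ (k : ℕ) (n : ℤ), 3 ^ k * a ≠ n) :
    IsStatSelfSimilarWith cantorMap (cantorDigitSet a) (cantorInter a) where
  similitude j := ⟨1 / 3, isSimilitude_cantorMap j⟩
  digits_nonempty := cantorDigitSet_nonempty a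
  openSetCondition := openSetCondition_cantorMap
  isCompact := isCompact_cantorInter a
  nonempty := cantorInter_nonempty (abs_le.2 ⟨by linarith [ha.1], ha.2.le⟩)
  tendsto _ hF hne := tendsto_hausdorffEDist_levelImage (by norm_num) (by norm_num) dist_cantorMap
    (cantorInter_eq_levelImage ha h) (fun k => cantorInter_nonempty (abs_cantorResidual_le a k))
    (fun _ => cantorInter_subset _) (Metric.isBounded_Icc 0 1) hF hne

end Digits

/-! ### Coding points of the Cantor set -/

section CantorPoint

/-- The point of the Cantor set with code `c`, where the letters `0`, `1` stand for the ternary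
digits `0`, `2`. -/
noncomputable def cantorPoint (c : ℕ → Fin 2) : ℝ :=
  Real.ofDigits fun k => (![0, 2] (c k) : Fin 3)

lemma cantorPoint_mem (c : ℕ → Fin 2) : cantorPoint c ∈ Set.Icc 0 1 :=
  ⟨Real.ofDigits_nonneg _, Real.ofDigits_le_one _⟩

lemma cantorPoint_eq_cantorMap (c : ℕ → Fin 2) :
    cantorPoint c = cantorMap (c 0) (cantorPoint fun i => c (i + 1)) := by
  have h := Real.ofDigits_eq_sum_add_ofDigits (fun k => (![0, 2] (c k) : Fin 3)) 1
  simp only [Finset.sum_range_one, Real.ofDigitsTerm] at h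
  rw [cantorPoint, cantorPoint, h]
  generalize c 0 = j
  fin_cases j
  · simp [cantorMap_zero]; ring
  · simp [cantorMap_one]; ring

lemma cantorPoint_eq_wordMap (c : ℕ → Fin 2) (k : ℕ) :
    cantorPoint c = wordMap cantorMap (fun i : Fin k => c i) (cantorPoint fun i => c (i + k)) := by
  induction k with
  | zero => simp [wordMap]
  | succ k ih =>
    rw [ih, wordMap, Function.comp_apply, cantorPoint_eq_cantorMap]
    simp only [zero_add, Fin.val_last, add_assoc, add_comm 1 k]
    rfl

lemma le_dist_cantorPoint_of_ne {c c' : ℕ → Fin 2} (h : c 0 ≠ c' 0) :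
    1 / 3 ≤ dist (cantorPoint c) (cantorPoint c') := by
  wlog h0 : c 0 = 0 generalizing c c'
  · rw [dist_comm]
    exact this h.symm (by omega)
  have h1 : c' 0 = 1 := by omega
  rw [cantorPoint_eq_cantorMap c, cantorPoint_eq_cantorMap c', h0, h1, cantorMap_zero,
    cantorMap_one, dist_comm, Real.dist_eq]
  have hx := cantorPoint_mem fun i => c (i + 1)
  have hy := cantorPoint_mem fun i => c' (i + 1)
  exact le_trans (by linarith [hx.2, hy.1]) (le_abs_self _)

/-- The common prefix scales the gap of length `1/3` between the two thirds by `3 ^ (-n)`. -/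
lemma le_dist_cantorPoint {c c' : ℕ → Fin 2} {n : ℕ} (heq : ∀ i < n, c i = c' i)
    (hne : c n ≠ c' n) : (1 / 3 : ℝ) ^ (n + 1) ≤ dist (cantorPoint c) (cantorPoint c') := by
  rw [cantorPoint_eq_wordMap c n, cantorPoint_eq_wordMap c' n,
    show (fun i : Fin n => c i) = fun i : Fin n => c' i from funext fun i => heq i i.2,
    dist_wordMap dist_cantorMap, pow_succ]
  gcongr
  exact le_dist_cantorPoint_of_ne (by simpa using hne)

lemma exists_first_ne {c c' : ℕ → Fin 2} (h : c ≠ c') :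
    ∃ n, (∀ i < n, c i = c' i) ∧ c n ≠ c' n := by
  classical
  have h' := Function.ne_iff.1 h
  exact ⟨Nat.find h', fun i hi => not_not.1 (Nat.find_min h' hi), Nat.find_spec h'⟩

lemma cantorPoint_injective : Function.Injective cantorPoint := by
  intro c c' h
  by_contra hne
  obtain ⟨n, hn, hn'⟩ := exists_first_ne hne
  have := le_dist_cantorPoint hn hn'
  rw [h, dist_self] at this
  exact absurd this (not_le.2 (by positivity))

lemma ediam_wordMap_image_le {n : ℕ} (w : Fin n → Fin 2) :
    Metric.ediam (wordMap cantorMap w '' Set.Icc 0 1) ≤ ENNReal.ofReal ((1 / 3) ^ n) := by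
  refine Metric.ediam_le ?_
  rintro _ ⟨x, hx, rfl⟩ _ ⟨y, hy, rfl⟩
  rw [edist_dist, dist_wordMap dist_cantorMap]
  refine ENNReal.ofReal_le_ofReal (mul_le_of_le_one_right (by positivity) ?_)
  have := Real.dist_le_of_mem_Icc hx hy
  linarith

variable {N : ℕ → Set (Fin 2)} {S : ℕ → Set ℝ} {E : Set ℝ}

lemma cantorPoint_mem_of_eq_levelImage (hE : ∀ k, E = levelImage cantorMap N k (S k))
    (hne : ∀ k, (S k).Nonempty) (hS : ∀ k, S k ⊆ Set.Icc 0 1) (hcl : IsClosed E)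
    {c : ℕ → Fin 2} (hc : ∀ k, c k ∈ N k) : cantorPoint c ∈ E := by
  rw [← hcl.closure_eq, Metric.mem_closure_iff]
  intro ε hε
  obtain ⟨k, hk⟩ := exists_pow_lt_of_lt_one hε (by norm_num : (1 / 3 : ℝ) < 1)
  obtain ⟨e, he⟩ := hne k
  refine ⟨wordMap cantorMap (fun i : Fin k => c i) e, ?_, ?_⟩
  · rw [hE k]
    exact wordMap_mem_levelImage (fun i => hc i) he
  · rw [cantorPoint_eq_wordMap c k, dist_wordMap dist_cantorMap]
    refine lt_of_le_of_lt (mul_le_of_le_one_right (by positivity) ?_) hk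
    have := Real.dist_le_of_mem_Icc (cantorPoint_mem fun i => c (i + k)) (hS k he)
    linarith

end CantorPoint

/-! ### Hausdorff dimension from the frequency of free places -/

section Dimension

variable {N : ℕ → Set (Fin 2)} {S : ℕ → Set ℝ} {E : Set ℝ}

open Classical in
lemma card_eq_ite {A : Set (Fin 2)} (hA : A.Nonempty) :
    Fintype.card A = if A = Set.univ then 2 else 1 := by
  split_ifs with h
  · subst h; simp
  · have h1 : Fintype.card A ≠ 0 := by
      have := hA.to_subtype
      exact Fintype.card_ne_zero
    have h2 : Fintype.card A < 2 := by
      obtain ⟨x, hx⟩ := (Set.ne_univ_iff_exists_notMem A).1 h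
      simpa using Fintype.card_subtype_lt (p := (· ∈ A)) hx
    omega

open Classical in
lemma prod_card_eq_two_pow_count (hN : ∀ k, (N k).Nonempty) (n : ℕ) :
    ∏ i : Fin n, Fintype.card (N i) = 2 ^ Nat.count (fun k => N k = Set.univ) n := by
  rw [Fin.prod_univ_eq_prod_range (fun i => Fintype.card (N i)) n]
  induction n with
  | zero => simp
  | succ n ih =>
    rw [Finset.prod_range_succ, ih, Nat.count_succ, pow_add, card_eq_ite (hN n)]
    split_ifs <;> simp

open Classical in
-- The admissible cylinders of level `n` number about `2 ^ (θ n)` and have diameter at most `3 ^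
-- (-n)`, so for exponents above `θ log 2 / log 3` their sums are eventually at most 1.
lemma dimH_le_of_eq_levelImage (hN : ∀ k, (N k).Nonempty)
    (hE : ∀ k, E = levelImage cantorMap N k (S k)) (hS : ∀ k, S k ⊆ Set.Icc 0 1) {θ : ℝ}
    (hθ0 : 0 < θ)
    (hθ : Tendsto (fun n : ℕ => (Nat.count (fun k => N k = Set.univ) n : ℝ) / n) atTop (𝓝 θ)) :
    dimH E ≤ ENNReal.ofReal (θ * Real.log 2 / Real.log 3) := by
  have hl2 : 0 < Real.log 2 := Real.log_pos (by norm_num)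
  have hl3 : 0 < Real.log 3 := Real.log_pos (by norm_num)
  refine le_of_forall_gt fun d' hd' => ?_
  obtain ⟨d, hd, hdd'⟩ := ENNReal.lt_iff_exists_nnreal_btwn.1 hd'
  refine lt_of_le_of_lt (dimH_le_of_hausdorffMeasure_ne_top (d := d) ?_) hdd'
  rw [ENNReal.ofReal_lt_coe_iff (by positivity), div_lt_iff₀ hl3, ← lt_div_iff₀ hl2] at hd
  have hcov : μH[d] E ≤ liminf (fun n => ∑ w : (∀ i : Fin n, N i),
      Metric.ediam (wordMap cantorMap (fun i => (w i : Fin 2)) '' Set.Icc 0 1) ^ (d : ℝ)) atTop := by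
    refine Measure.hausdorffMeasure_le_liminf_sum (d : ℝ) E
      (fun n : ℕ => ENNReal.ofReal ((1 / 3) ^ n)) ?_ _ (Eventually.of_forall fun n w => ?_)
      (Eventually.of_forall fun n => ?_)
    · have := tendsto_pow_atTop_nhds_zero_of_lt_one (by norm_num : (0 : ℝ) ≤ 1 / 3) (by norm_num)
      simpa using ENNReal.tendsto_ofReal this
    · exact ediam_wordMap_image_le _
    · conv_lhs => rw [hE n]
      intro x hx
      simp only [levelImage, Set.mem_iUnion, exists_prop] at hx
      obtain ⟨w, hw, y, hy, rfl⟩ := hx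
      exact Set.mem_iUnion.2 ⟨fun i => ⟨w i, hw i⟩, y, hS n hy, rfl⟩
  refine ne_top_of_le_ne_top ENNReal.one_ne_top (hcov.trans
    (liminf_le_of_frequently_le' (Eventually.frequently ?_)))
  filter_upwards [hθ.eventually (gt_mem_nhds hd), eventually_gt_atTop 0] with n hn hn0
  have hn0' : (0 : ℝ) < n := by exact_mod_cast hn0
  rw [div_lt_div_iff₀ hn0' hl2] at hn
  calc
    _ ≤ ∑ _w : (∀ i : Fin n, N i), ENNReal.ofReal ((1 / 3) ^ n) ^ (d : ℝ) := by
      gcongr with w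
      exact ediam_wordMap_image_le _
    _ = ENNReal.ofReal (2 ^ Nat.count (fun k => N k = Set.univ) n * ((1 / 3) ^ n) ^ (d : ℝ)) := by
      rw [Finset.sum_const, Finset.card_univ, Fintype.card_pi, prod_card_eq_two_pow_count hN,
        nsmul_eq_mul, ENNReal.ofReal_mul (by positivity),
        ENNReal.ofReal_rpow_of_pos (by positivity), ENNReal.ofReal_pow (by norm_num)]
      norm_num
    _ ≤ ENNReal.ofReal 1 := by
      gcongr
      rw [← Real.log_nonpos_iff (by positivity), Real.log_mul (by positivity) (by positivity),
        Real.log_rpow (by positivity), Real.log_pow, Real.log_pow, one_div, Real.log_inv]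
      linarith
    _ = 1 := ENNReal.ofReal_one

open Classical in
-- The Hölder estimate for codes that first differ at place `n`: binary precision on the left,
-- separation of the Cantor points on the right.
lemma exists_two_pow_count_le {θ β : ℝ} {p : ℕ → Prop}
    (hθ : Tendsto (fun n : ℕ => (Nat.count p n : ℝ) / n) atTop (𝓝 θ))
    (hβ : β < θ * Real.log 2 / Real.log 3) :
    ∃ C : NNReal, ∀ n, ((2 : ℝ) ^ Nat.count p n)⁻¹ ≤ C * ((1 / 3 : ℝ) ^ (n + 1)) ^ β := by
  have hl2 : 0 < Real.log 2 := Real.log_pos (by norm_num)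
  have hl3 : 0 < Real.log 3 := Real.log_pos (by norm_num)
  rw [lt_div_iff₀ hl3, ← div_lt_iff₀ hl2] at hβ
  have hev : ∀ᶠ n : ℕ in atTop,
      -- The bound `3 ^ β` absorbs the extra 1 in the exponent `n + 1`; the finitely many other `n`
      -- only enlarge `C`.
      ((2 : ℝ) ^ Nat.count p n)⁻¹ / ((1 / 3 : ℝ) ^ (n + 1)) ^ β ≤ 3 ^ β := by
    filter_upwards [hθ.eventually (lt_mem_nhds hβ), eventually_gt_atTop 0] with n hn hn0
    have hn0' : (0 : ℝ) < n := by exact_mod_cast hn0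
    rw [div_lt_div_iff₀ hl2 hn0'] at hn
    rw [← Real.log_le_log_iff (by positivity) (by positivity),
      Real.log_div (by positivity) (by positivity), Real.log_rpow (by positivity),
      Real.log_rpow (by positivity), Real.log_inv, Real.log_pow, Real.log_pow, one_div,
      Real.log_inv]
    push_cast
    linarith
  obtain ⟨C, hC⟩ := (isBoundedUnder_of_eventually_le hev).bddAbove_range
  refine ⟨C.toNNReal, fun n => ?_⟩
  rw [← div_le_iff₀ (by positivity)]
  exact (hC ⟨n, rfl⟩).trans (Real.le_coe_toNNReal C)

/-- Ensures that `Nat.nth p` really enumerates the free places, with no default values. -/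
lemma infinite_of_tendsto_count {θ : ℝ} (hθ0 : 0 < θ) {p : ℕ → Prop} [DecidablePred p]
    (hθ : Tendsto (fun n : ℕ => (Nat.count p n : ℝ) / n) atTop (𝓝 θ)) : {k | p k}.Infinite := by
  intro hfin
  have hb : ∀ n, Nat.count p n ≤ hfin.toFinset.card := fun n => by
    rw [Nat.count_eq_card_filter_range]
    exact Finset.card_le_card fun k hk => by simpa using (Finset.mem_filter.1 hk).2
  have h0 : Tendsto (fun n : ℕ => (Nat.count p n : ℝ) / n) atTop (𝓝 0) :=
    squeeze_zero (fun n => by positivity)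
      (fun n => div_le_div_of_nonneg_right (by exact_mod_cast hb n) n.cast_nonneg)
      (tendsto_const_div_atTop_nhds_zero_nat (hfin.toFinset.card : ℝ))
  exact hθ0.ne' (tendsto_nhds_unique hθ h0)

open Classical in
lemma le_dimH_of_eq_levelImage (hN : ∀ k, (N k).Nonempty)
    (hE : ∀ k, E = levelImage cantorMap N k (S k)) (hne : ∀ k, (S k).Nonempty)
    (hS : ∀ k, S k ⊆ Set.Icc 0 1) (hcl : IsClosed E) {θ : ℝ} (hθ0 : 0 < θ)
    (hθ : Tendsto (fun n : ℕ => (Nat.count (fun k => N k = Set.univ) n : ℝ) / n) atTop (𝓝 θ)) :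
    ENNReal.ofReal (θ * Real.log 2 / Real.log 3) ≤ dimH E := by
  have hinf := infinite_of_tendsto_count hθ0 hθ
  set p : ℕ → Prop := fun k => N k = Set.univ
  refine le_of_forall_lt fun b' hb' => ?_
  obtain ⟨β, hβ', hβ⟩ := ENNReal.lt_iff_exists_nnreal_btwn.1 hb'
  refine lt_of_lt_of_le hβ' ?_
  have hβ0 : 0 < β := by
    have := (zero_le (a := b')).trans_lt hβ'
    exact_mod_cast this
  rw [← ENNReal.ofReal_coe_nnreal, ENNReal.ofReal_lt_ofReal_iff_of_nonneg β.coe_nonneg] at hβ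
  obtain ⟨C, hC⟩ := exists_two_pow_count_le hθ hβ
  set T : Set ℝ := cantorPoint '' {c | ∀ k, c k ∈ N k}
  have hTE : T ⊆ E := by
    rintro _ ⟨c, hc, rfl⟩
    exact cantorPoint_mem_of_eq_levelImage hE hne hS hcl hc
  -- Decodes `x` and reads its letters at the free places as binary digits; values off the range of
  -- `cantorPoint` play no role.
  set f : ℝ → ℝ := fun x =>
    Real.ofDigits fun j => Function.invFun cantorPoint x (Nat.nth p j)
  have hf : ∀ c, f (cantorPoint c) = Real.ofDigits fun j => c (Nat.nth p j) := fun c => by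
    simp only [f, Function.leftInverse_invFun cantorPoint_injective c]
  have hsurj : Set.Ico 0 1 ⊆ f '' T := by
    intro t ht
    choose e he using hN
    -- The binary digits of `t` are spread over the free places; elsewhere any allowed letter is
    -- used.
    set c : ℕ → Fin 2 := fun k => if p k then Real.digits t 2 (Nat.count p k) else e k
    refine ⟨cantorPoint c, ⟨c, fun k => ?_, rfl⟩, ?_⟩
    · by_cases hk : p k
      · rw [show N k = Set.univ from hk]; trivial
      · simpa only [c, if_neg hk] using he k
    · rw [hf]
      have : (fun j => c (Nat.nth p j)) = Real.digits t 2 := by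
        ext1 j
        simp only [c, if_pos (Nat.nth_mem_of_infinite hinf j), Nat.count_nth_of_infinite hinf]
      rw [this, Real.ofDigits_digits (by norm_num) ht]
  have hhol : HolderOnWith C β f T := by
    rintro _ ⟨c, -, rfl⟩ _ ⟨c', -, rfl⟩
    rcases eq_or_ne c c' with rfl | hcc
    · simp
    obtain ⟨n, hn, hn'⟩ := exists_first_ne hcc
    -- There are `Nat.count p n` free places before `n`, so that many binary digits agree.
    have h1 : |f (cantorPoint c) - f (cantorPoint c')| ≤ ((2 : ℝ) ^ Nat.count p n)⁻¹ := by
      rw [hf, hf]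
      exact_mod_cast Real.abs_ofDigits_sub_ofDigits_le (n := Nat.count p n)
        fun i hi => hn _ (Nat.nth_lt_of_lt_count hi)
    have h2 := le_dist_cantorPoint hn hn'
    rw [edist_dist, edist_dist, ENNReal.ofReal_rpow_of_nonneg dist_nonneg β.coe_nonneg,
      ← ENNReal.ofReal_coe_nnreal, ← ENNReal.ofReal_mul C.coe_nonneg, Real.dist_eq]
    refine ENNReal.ofReal_le_ofReal (h1.trans ((hC n).trans ?_))
    gcongr
  have h1 : (1 : ENNReal) ≤ dimH (f '' T) := by
    refine le_trans (le_of_eq ?_) (dimH_mono hsurj)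
    rw [Real.dimH_of_nonempty_interior (by simp [interior_Ico])]
    simp
  have h2 := (h1.trans (hhol.dimH_image_le hβ0)).trans
    (ENNReal.div_le_div_right (dimH_mono hTE) _)
  rwa [ENNReal.le_div_iff_mul_le (by simp [hβ0.ne']) (by simp), one_mul] at h2

end Dimension

/-! ### The tripling map on the circle and the strong law -/

section Tripling

open ProbabilityTheory

lemma measurable_nsmul_unitAddCircle (n : ℕ) : Measurable fun x : UnitAddCircle => n • x :=
  (continuous_nsmul n).measurable

lemma measurePreserving_pow_three_nsmul (k : ℕ) :
    MeasurePreserving (fun x : UnitAddCircle => 3 ^ k • x) := by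
  rcases Nat.eq_zero_or_pos k with rfl | hk
  · simp only [pow_zero, one_smul]
    exact MeasurePreserving.id (volume : Measure UnitAddCircle)
  · exact (AddCircle.ergodic_nsmul (Nat.one_lt_pow hk.ne' (by norm_num))).toMeasurePreserving

/-- The tripling map sends the arc of length `1 / 3` around `0` bijectively onto the circle, up to
null sets, and multiplies lengths by `3`. -/
lemma volume_ball_inter_preimage_three_nsmul {B : Set UnitAddCircle} (hB : MeasurableSet B) :
    volume (Metric.ball (0 : UnitAddCircle) (1 / 6) ∩ (fun x => 3 • x) ⁻¹' B) =
      ENNReal.ofReal (1 / 3) * volume B := by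
  have hm : MeasurableSet (Metric.ball (0 : UnitAddCircle) (1 / 6) ∩ (fun x => 3 • x) ⁻¹' B) :=
    measurableSet_ball.inter (measurable_nsmul_unitAddCircle 3 hB)
  rw [AddCircle.add_projection_respects_measure 1 (-(1 / 2)) hm,
    AddCircle.add_projection_respects_measure 1 (-(1 / 2)) hB]
  -- On the fundamental domain `(-1/2, 1/2]` the ball is `|x| < 1/6`, which says that `3 * x` lies
  -- in the open domain; the missing endpoint is null.
  have hset : (QuotientAddGroup.mk ⁻¹' (Metric.ball (0 : UnitAddCircle) (1 / 6) ∩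
      (fun x => 3 • x) ⁻¹' B) ∩ Set.Ioc (-(1 / 2)) (-(1 / 2) + 1) : Set ℝ) =
      (fun x : ℝ => 3 * x) ⁻¹'
        (QuotientAddGroup.mk ⁻¹' B ∩ Set.Ioo (-(1 / 2)) (-(1 / 2) + 1)) := by
    ext x
    have hmk : ((3 * x : ℝ) : UnitAddCircle) = 3 • (x : UnitAddCircle) := by
      rw [← AddCircle.coe_nsmul, nsmul_eq_mul]; norm_num
    have hnorm : |x| ≤ 1 / 2 → ‖(x : UnitAddCircle)‖ = |x| := fun h =>
      (AddCircle.norm_coe_eq_abs_iff (1 : ℝ) one_ne_zero).2 (by simpa using h)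
    constructor
    · rintro ⟨⟨h1, h2⟩, h3, h4⟩
      have h1' : ‖(x : UnitAddCircle)‖ < 1 / 6 := by simpa using h1
      rw [hnorm (abs_le.2 ⟨by linarith, by linarith⟩), abs_lt] at h1'
      refine ⟨?_, by constructor <;> linarith⟩
      show ((3 * x : ℝ) : UnitAddCircle) ∈ B
      rw [hmk]; exact h2
    · rintro ⟨h1, h3, h4⟩
      simp only at h3 h4
      have h1' : ((3 * x : ℝ) : UnitAddCircle) ∈ B := h1
      rw [hmk] at h1'
      refine ⟨⟨?_, h1'⟩, by constructor <;> linarith⟩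
      show (x : UnitAddCircle) ∈ _
      rw [mem_ball_zero_iff, hnorm (abs_le.2 ⟨by linarith, by linarith⟩), abs_lt]
      constructor <;> linarith
  rw [hset, Real.volume_preimage_mul_left (by norm_num),
    measure_congr ((ae_eq_refl (QuotientAddGroup.mk ⁻¹' B : Set ℝ)).inter Ioo_ae_eq_Ioc)]
  norm_num

lemma volume_ball_sixth :
    volume (Metric.ball (0 : UnitAddCircle) (1 / 6)) = ENNReal.ofReal (1 / 3) := by
  simpa using volume_ball_inter_preimage_three_nsmul MeasurableSet.univ

/-- The set of points of the circle whose image under `x ↦ 3 ^ k • x` has norm below `1 / 6`. -/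
def returnSet (k : ℕ) : Set UnitAddCircle :=
  (fun x : UnitAddCircle => 3 ^ k • x) ⁻¹' Metric.ball 0 (1 / 6)

lemma measurableSet_returnSet (k : ℕ) : MeasurableSet (returnSet k) :=
  measurable_nsmul_unitAddCircle _ measurableSet_ball

lemma volume_returnSet (k : ℕ) : volume (returnSet k) = ENNReal.ofReal (1 / 3) := by
  rw [returnSet, (measurePreserving_pow_three_nsmul k).measure_preimage
    measurableSet_ball.nullMeasurableSet, volume_ball_sixth]

/-- Invariance under `3 ^ j` reduces to `j = 0`; there one tripling spreads the ball over the whole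
circle, so the later return is independent of it. -/
lemma volume_returnSet_inter {j k : ℕ} (h : j < k) :
    volume (returnSet j ∩ returnSet k) = volume (returnSet j) * volume (returnSet k) := by
  obtain ⟨l, rfl⟩ := Nat.exists_eq_add_of_lt h
  have hset : returnSet j ∩ returnSet (j + l + 1) = (fun x : UnitAddCircle => 3 ^ j • x) ⁻¹'
      (Metric.ball 0 (1 / 6) ∩ (fun x => 3 • x) ⁻¹' returnSet l) := by
    ext x
    simp only [returnSet, Set.mem_inter_iff, Set.mem_preimage, smul_smul]
    rw [show 3 ^ (j + l + 1) = 3 ^ l * (3 * 3 ^ j) by ring]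
  rw [hset, (measurePreserving_pow_three_nsmul j).measure_preimage
    (measurableSet_ball.inter (measurable_nsmul_unitAddCircle 3
      (measurableSet_returnSet l))).nullMeasurableSet,
    volume_ball_inter_preimage_three_nsmul (measurableSet_returnSet l)]
  simp only [volume_returnSet]

lemma indepSet_returnSet {j k : ℕ} (h : j ≠ k) :
    IndepSet (returnSet j) (returnSet k) (volume : Measure UnitAddCircle) := by
  have : IsProbabilityMeasure (volume : Measure UnitAddCircle) := ⟨UnitAddCircle.measure_univ⟩
  refine (indepSet_iff_measure_inter_eq_mul (measurableSet_returnSet j)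
    (measurableSet_returnSet k) _).2 ?_
  rcases lt_or_gt_of_ne h with h | h
  · exact volume_returnSet_inter h
  · rw [Set.inter_comm, mul_comm, volume_returnSet_inter h]

lemma ProbabilityTheory.IndepSet.indepFun_indicator_one {Ω : Type*} [MeasurableSpace Ω]
    {μ : Measure Ω} {s t : Set Ω} (h : IndepSet s t μ) :
    IndepFun (s.indicator fun _ => (1 : ℝ)) (t.indicator fun _ => (1 : ℝ)) μ := by
  have hcomap : ∀ u : Set Ω, MeasurableSpace.comap (u.indicator fun _ => (1 : ℝ)) inferInstance ≤
      MeasurableSpace.generateFrom {u} := fun u =>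
    Measurable.comap_le (measurable_const.indicator
      (MeasurableSpace.measurableSet_generateFrom rfl))
  exact indep_of_indep_of_le_left (indep_of_indep_of_le_right h (hcomap t)) (hcomap s)

lemma ae_tendsto_sum_indicator_returnSet :
    ∀ᵐ x : UnitAddCircle, Tendsto (fun n : ℕ =>
      (∑ k ∈ Finset.range n, (returnSet k).indicator (fun _ => (1 : ℝ)) x) / n)
      atTop (𝓝 (1 / 3)) := by
  have hmeas : ∀ k, Measurable ((returnSet k).indicator fun _ => (1 : ℝ)) := fun k =>
    measurable_const.indicator (measurableSet_returnSet k)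
  have hcomp : ∀ k, (returnSet k).indicator (fun _ => (1 : ℝ)) =
      (returnSet 0).indicator (fun _ => (1 : ℝ)) ∘ fun x => 3 ^ k • x := fun k => by
    ext x
    simp [Set.indicator, returnSet]
  have hint : ∫ x, (returnSet 0).indicator (fun _ => (1 : ℝ)) x = 1 / 3 := by
    rw [integral_indicator_const _ (measurableSet_returnSet 0), measureReal_def, volume_returnSet,
      ENNReal.toReal_ofReal (by norm_num), smul_eq_mul, mul_one]
  -- This strong law asks only for pairwise independence; invariance of the measure gives identical
  -- distribution.
  have := strong_law_ae_real (μ := (volume : Measure UnitAddCircle))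
    (fun k => (returnSet k).indicator fun _ => (1 : ℝ))
    ((integrable_const 1).indicator (measurableSet_returnSet 0))
    (fun j k hjk => (indepSet_returnSet hjk).indepFun_indicator_one)
    (fun k => ⟨(hmeas k).aemeasurable, (hmeas 0).aemeasurable, by
      rw [hcomp k, ← Measure.map_map (hmeas 0) (measurable_nsmul_unitAddCircle _),
        (measurePreserving_pow_three_nsmul k).map_eq]⟩)
  rwa [hint] at this

end Tripling

/-! ### Frequency of free places for almost every `a` -/

section Frequency

lemma cantorDigitSet_eq_univ_iff_even (a : ℝ) (k : ℕ) :
    cantorDigitSet a k = Set.univ ↔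
      Even (∑ i ∈ Finset.range k, triadicDigit a i) ∧ triadicDigit a k = 0 ∨
      ¬ Even (∑ i ∈ Finset.range k, triadicDigit a i) ∧ triadicDigit a k = 2 := by
  have h01 : ({0, 1} : Set (Fin 2)) = Set.univ := by
    ext i; fin_cases i <;> simp
  have h0 : ({0} : Set (Fin 2)) ≠ Set.univ := fun h => by
    simpa using h.ge (Set.mem_univ 1)
  have h1 : ({1} : Set (Fin 2)) ≠ Set.univ := fun h => by
    simpa using h.ge (Set.mem_univ 0)
  unfold cantorDigitSet
  split_ifs with he hd hd <;> simp [he, hd, h01, h0, h1]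

/-- Halving turns distance to the even integers into distance to the integers, and the radius `1/3`
into `1/6`. -/
lemma coe_div_two_mem_returnSet_iff (a : ℝ) (k : ℕ) :
    ((a / 2 : ℝ) : UnitAddCircle) ∈ returnSet k ↔ ∃ n : ℤ, |3 ^ k * a - 2 * n| < 1 / 3 := by
  have habs : ∀ y : ℝ, |3 ^ k * a - 2 * y| = 2 * |3 ^ k * (a / 2) - y| := fun y => by
    rw [← abs_of_pos (by norm_num : (0 : ℝ) < 2), ← abs_mul, abs_of_pos (by norm_num : (0 : ℝ) < 2)]
    congr 1; ring
  rw [returnSet, Set.mem_preimage, ← AddCircle.coe_nsmul, mem_ball_zero_iff, UnitAddCircle.norm_eq,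
    nsmul_eq_mul]
  push_cast
  constructor
  · intro h
    refine ⟨round (3 ^ k * (a / 2)), ?_⟩
    rw [habs]
    linarith
  · rintro ⟨n, hn⟩
    rw [habs] at hn
    linarith [round_le (3 ^ k * (a / 2)) n]

lemma cantorDigitSet_eq_univ_iff {a : ℝ} (ha : a ∈ Set.Ico 0 1)
    (h : ∀ (k : ℕ) (n : ℤ), 3 ^ k * a ≠ n) (k : ℕ) :
    cantorDigitSet a k = Set.univ ↔ ((a / 2 : ℝ) : UnitAddCircle) ∈ returnSet k := by
  rw [cantorDigitSet_eq_univ_iff_even, even_sum_triadicDigit_iff ha, coe_div_two_mem_returnSet_iff]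
  have hs := triadicShift_succ ha.1 k
  have h0 := triadicShift_pos h (k + 1)
  have h1 := triadicShift_lt_one a (k + 1)
  have h0' := triadicShift_pos h k
  have h1' := triadicShift_lt_one a k
  have hlt := triadicDigit_lt a k
  have hu := triadicShift_eq ha.1 k
  generalize ⌊3 ^ k * a⌋₊ = m at *
  generalize triadicDigit a k = d at *
  rw [show (3 : ℝ) ^ k * a = triadicShift a k + m by linarith]
  constructor
  · rintro (⟨⟨q, rfl⟩, rfl⟩ | ⟨hm, rfl⟩)
    · refine ⟨q, abs_lt.2 ?_⟩
      push_cast at hs ⊢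
      constructor <;> linarith
    · obtain ⟨q, rfl⟩ := Nat.not_even_iff_odd.1 hm
      refine ⟨q + 1, abs_lt.2 ?_⟩
      push_cast at hs ⊢
      constructor <;> linarith
  · rintro ⟨n, hn⟩
    obtain ⟨hn1, hn2⟩ := abs_lt.1 hn
    have hlo : -2 < (m : ℤ) - 2 * n := by
      have : (-2 : ℝ) < (m : ℝ) - 2 * n := by linarith
      exact_mod_cast this
    have hhi : (m : ℤ) - 2 * n < 1 := by
      have : (m : ℝ) - 2 * n < 1 := by linarith
      exact_mod_cast this
    -- The nearby even integer is either the floor of `3 ^ k * a`, and the fractional part is below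
    -- `1/3` (digit 0), or the floor plus one, and it is above `2/3` (digit 2).
    obtain hm | hm : (m : ℤ) = 2 * n ∨ (m : ℤ) = 2 * n - 1 := by omega
    · left
      have hm' : (m : ℝ) = 2 * n := by exact_mod_cast hm
      have hd : (d : ℝ) < 1 := by linarith
      exact ⟨by rw [Nat.even_iff]; omega, by have : d < 1 := by exact_mod_cast hd
                                             omega⟩
    · right
      have hm' : (m : ℝ) = 2 * n - 1 := by exact_mod_cast hm
      have hd : (1 : ℝ) < d := by linarith
      exact ⟨by rw [Nat.even_iff]; omega, by have : 1 < d := by exact_mod_cast hd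
                                             omega⟩

lemma ae_not_triadic : ∀ᵐ a : ℝ, ∀ (k : ℕ) (n : ℤ), 3 ^ k * a ≠ n := by
  rw [ae_all_iff]
  intro k
  rw [ae_all_iff]
  intro n
  filter_upwards [Measure.ae_ne volume ((n : ℝ) / 3 ^ k)] with a ha h
  exact ha (by rw [← h]; field_simp)

lemma ae_tendsto_count_cantorDigitSet : ∀ᵐ a : ℝ ∂(volume.restrict (Set.Icc (0 : ℝ) 1)),
    a ∈ Set.Ico 0 1 ∧ (∀ (k : ℕ) (n : ℤ), 3 ^ k * a ≠ n) ∧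
    ∀ (_ : DecidablePred fun k => cantorDigitSet a k = Set.univ),
    Tendsto (fun n : ℕ => (Nat.count (fun k => cantorDigitSet a k = Set.univ) n : ℝ) / n) atTop
      (𝓝 (1 / 3)) := by
  have h1 := (AddCircle.measurePreserving_mk 1 0).quasiMeasurePreserving.ae
    ae_tendsto_sum_indicator_returnSet
  rw [ae_restrict_iff' measurableSet_Ioc] at h1
  -- Halving pulls null sets back to null sets, which transfers the almost-sure statement from `a /
  -- 2` to `a`.
  have h2 : Measure.QuasiMeasurePreserving (fun a : ℝ => a / 2) := by
    simpa [div_eq_inv_mul] using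
      Measure.quasiMeasurePreserving_smul (volume : Measure ℝ) (by norm_num : (2⁻¹ : ℝ) ≠ 0)
  have h3 := h2.ae h1
  rw [ae_restrict_iff' measurableSet_Icc]
  filter_upwards [h3, ae_not_triadic] with a ha hna ⟨ha0, ha1⟩
  have hne0 : a ≠ 0 := by simpa using hna 0 0
  have hne1 : a ≠ 1 := by simpa using hna 0 1
  have hmem : a ∈ Set.Ico 0 1 := ⟨ha0, lt_of_le_of_ne ha1 hne1⟩
  refine ⟨hmem, hna, fun _ => ?_⟩
  have hpos : 0 < a := lt_of_le_of_ne ha0 hne0.symm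
  refine (ha ⟨by positivity, by linarith⟩).congr fun n => ?_
  congr 1
  rw [Nat.count_eq_card_filter_range, Finset.card_filter, Nat.cast_sum]
  refine Finset.sum_congr rfl fun k _ => ?_
  by_cases hk : cantorDigitSet a k = Set.univ
  · rw [Set.indicator_of_mem ((cantorDigitSet_eq_univ_iff hmem hna k).1 hk), if_pos hk]
    simp
  · rw [Set.indicator_of_notMem (fun h => hk ((cantorDigitSet_eq_univ_iff hmem hna k).2 h)),
      if_neg hk]
    simp

end Frequency

theorem theorem3 :
    ∀ᵐ a : ℝ ∂(volume.restrict (Set.Icc (0 : ℝ) 1)),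
      IsStatSelfSimilar (cantorInter a) ∧
      IsStatSelfSimilarWith cantorMap (cantorDigitSet a) (cantorInter a) ∧
      dimH (cantorInter a) = ENNReal.ofReal (Real.log 2 / (3 * Real.log 3)) := by
  filter_upwards [ae_tendsto_count_cantorDigitSet] with a ⟨ha, hna, hlim⟩
  have hss := isStatSelfSimilarWith_cantorInter ha hna
  refine ⟨⟨2, cantorMap, cantorDigitSet a, hss⟩, hss, ?_⟩
  have hE := cantorInter_eq_levelImage ha hna
  have hS : ∀ k, cantorInter (cantorResidual a k) ⊆ Set.Icc 0 1 := fun k => cantorInter_subset _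
  have hθ := hlim fun _ => Classical.propDecidable _
  rw [show Real.log 2 / (3 * Real.log 3) = 1 / 3 * Real.log 2 / Real.log 3 by
    rw [div_mul_eq_div_div]; ring]
  exact le_antisymm
    (dimH_le_of_eq_levelImage (cantorDigitSet_nonempty a) hE hS (by norm_num) hθ)
    (le_dimH_of_eq_levelImage (cantorDigitSet_nonempty a) hE
      (fun k => cantorInter_nonempty (abs_cantorResidual_le a k)) hS hss.isCompact.isClosed
      (by norm_num) hθ)
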